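/- Let $n\in\mathbb N=\{1,2,\dots\}$, $\gamma\in(0,\infty)$, $p\in[1,\infty)$, and let $q\in(0,\infty)$ satisfy $n\left(\frac1p-\frac1q\right)<1$. For a nonnegative locally integrable function $\omega$ on $\mathbb R^n$, put $$[\omega]_{A_1(\mathbb R^n)}:=\sup_{Q}\frac{\|\omega^{-1}\|_{L^\infty(Q)}}{|Q|}\int_Q\omega(x)\,dx,$$ where the supremum is taken over all cubes $Q\subset\mathbb R^n$ with edges parallel to the coordinate axes, and write $\omega\in A_1(\mathbb R^n)$ if $[\omega]_{A_1(\mathbb R^n)}<\infty$. For a function $f$ on $\mathbb R^n$, $\lambda\in(0,\infty)$ and $b\in\mathbb R$, let $$E_{\lambda,b}[f]:=\left\{(x,y)\in\mathbb R^n\times\mathbb R^n:\ x\neq y,\ \frac{|f(x)-f(y)|}{|x-y|^{1+b}}>\lambda\right\}.$$ Then there exists a positive, continuous and increasing function $t\mapsto C_{(t)}$ on $[1,\infty)$, depending only on $n$, $\gamma$, $p$ and $q$, such that, for any $\omega\in A_1(\mathbb R^n)$ and any (real- or complex-valued) $f\in C^1(\mathbb R^n)$ whose gradient length $|\nabla f|$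 is continuous with compact support, $$\sup_{\lambda\in(0,\infty)}\lambda^p\int_{\mathbb R^n}\left[\int_{\mathbb R^n}\mathbf 1_{E_{\lambda,\gamma/q}[f]}(x,y)\,|x-y|^{\gamma-n}\,dy\right]^{p/q}\omega(x)\,dx\le C_{([\omega]_{A_1(\mathbb R^n)})}\int_{\mathbb R^n}|\nabla f(x)|^p\,\omega(x)\,dx.$$ -/

import Mathlib

open MeasureTheory Set
open scoped ENNReal

noncomputable section

/-- The closed cube in `ℝⁿ` with edges parallel to the coordinate axes, lower corner `a` and
edge length `l`. -/
def cube {n : ℕ} (a : EuclideanSpace ℝ (Fin n)) (l : ℝ) : Set (EuclideanSpace ℝ (Fin n)) :=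
  {x | ∀ i, x i ∈ Icc (a i) (a i + l)}

/-- The Muckenhoupt constant `[ω]_{A₁}`, as an extended nonnegative number: the supremum over all
cubes `Q` of `(‖ω⁻¹‖_{L^∞(Q)} / |Q|) * ∫_Q ω`. The inverse is taken in `[0, ∞]`, so that `ω⁻¹ = ∞`
where `ω` vanishes. -/
def muckenhouptA1Const {n : ℕ} (ω : EuclideanSpace ℝ (Fin n) → ℝ) : ℝ≥0∞ :=
  ⨆ (a : EuclideanSpace ℝ (Fin n)) (l : ℝ) (_ : 0 < l),
    essSup (fun x => (ENNReal.ofReal (ω x))⁻¹) (volume.restrict (cube a l)) / volume (cube a l) *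
      ∫⁻ x in cube a l, ENNReal.ofReal (ω x)

/-- `ω` is an `A₁(ℝⁿ)`-weight: a nonnegative locally integrable function with finite
`A₁`-constant. -/
structure IsMuckenhouptA1 {n : ℕ} (ω : EuclideanSpace ℝ (Fin n) → ℝ) : Prop where
  nonneg : ∀ x, 0 ≤ ω x
  locallyIntegrable : LocallyIntegrable ω volume
  const_lt_top : muckenhouptA1Const ω < ∞

/-- The Euclidean length `|∇f(x)| = (∑ⱼ |∂ⱼ f(x)|²)^{1/2}` of the gradient of a real- or
complex-valued function on `ℝⁿ`. -/
def gradNorm {n : ℕ} {𝕜 : Type*} [RCLike 𝕜] (f : EuclideanSpace ℝ (Fin n) → 𝕜)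
    (x : EuclideanSpace ℝ (Fin n)) : ℝ :=
  Real.sqrt (∑ j : Fin n, ‖fderiv ℝ f x (EuclideanSpace.single j 1)‖ ^ 2)

/-- The set `E_{lam, b}[f]` of all `(x, y)` with `x ≠ y` and
`|f(x) - f(y)| / |x - y|^{1 + b} > lam`. -/
def diffQuotSet {n : ℕ} {𝕜 : Type*} [RCLike 𝕜] (lam b : ℝ) (f : EuclideanSpace ℝ (Fin n) → 𝕜) :
    Set (EuclideanSpace ℝ (Fin n) × EuclideanSpace ℝ (Fin n)) :=
  {z | z.1 ≠ z.2 ∧ lam < ‖f z.1 - f z.2‖ / ‖z.1 - z.2‖ ^ (1 + b)}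

end

/-! Put `b = γ / q`, `s = p / q`, and suppose first that `p ≤ q`. Fix `a < 1` with `n (1/p - 1/q) <
a`. Let `(x, y)` lie in the level set and `r = |x - y|`. If for every `j` the averages of `|∇f|`
over the balls of radius `2^{-j} r` about `x` and `y` were at most a small multiple of `lam r^b
2^{ja}`, integrating `∇f` along segments would make `|f x - f y|` too small; `a < 1` makes this
converge (`exists_lt_setLIntegral_gradNorm`). So some such ball, of radius `ρ = 2^{-j} r`, has
average above `κ_j ρ^b`, where `κ_j` is a constant times `lam 2^{j(a+b)}`.

For each `j`, Vitali's lemma replaces these balls by a disjoint family, and the level set is covered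
by the pairs at distance at most `2^{j+1} ρ` with one point in the tripled ball. The kernel integral
over such pairs is dominated by a step function on dilates of the ball
(`setLIntegral_ballSection_le`). As `s ≤ 1`, the power `s` passes inside all sums. The `A₁`
condition bounds the mass of a dilated ball, times the `p`-th power of the average over the ball, by
the integral of `|∇f|^p ω` over the undilated ball (`IsMuckenhouptA1.rpow_mul_setLIntegral_le`);
disjointness then sums over the balls. Level `j` costs `(j + 1) 2^{j(n(1-s) - pa)}`, which is
summable by the choice of `a`. The bound is linear in the `A₁` constant.

If `p > q`, `rpow_setLIntegral_rieszKernel_le` absorbs the outer power `p / q > 1` into the kernel,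
which reduces to the case of equal exponents with `γ p / q` in place of `γ`. -/

/-! ### Integrals of the Riesz kernel, and powers of sums. -/

/-- A dilation of ratio `t` centred at `x` changes integrals over balls by the factor `t ^ n`. -/
theorem setLIntegral_closedBall_comp_dilation {n : ℕ} (x : EuclideanSpace ℝ (Fin n)) {t : ℝ}
    (ht : 0 < t) (r : ℝ) {F : EuclideanSpace ℝ (Fin n) → ℝ≥0∞} (hF : Measurable F) :
    ENNReal.ofReal (t ^ n) * ∫⁻ z in Metric.closedBall x r, F (x + t • (z - x)) =
      ∫⁻ w in Metric.closedBall x (t * r), F w := by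
  have hmap : Measure.map (fun z : EuclideanSpace ℝ (Fin n) => x + t • (z - x)) volume =
      ENNReal.ofReal (|(t ^ n)⁻¹|) • volume := by
    have h1 : (fun z : EuclideanSpace ℝ (Fin n) => x + t • (z - x)) =
        (fun z => (x - t • x) + z) ∘ (fun z => t • z) := by
      ext1 z; simp only [Function.comp, smul_sub]; abel
    rw [h1, ← Measure.map_map (by fun_prop) (by fun_prop),
      Measure.map_addHaar_smul volume ht.ne', Measure.map_smul, map_add_left_eq_self]
    simp
  have hmeas : Measurable (fun z : EuclideanSpace ℝ (Fin n) => x + t • (z - x)) := by fun_prop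
  have hpre : (fun z : EuclideanSpace ℝ (Fin n) => x + t • (z - x)) ⁻¹'
      Metric.closedBall x (t * r) = Metric.closedBall x r := by
    ext z
    simp only [mem_preimage, Metric.mem_closedBall, dist_eq_norm, add_sub_cancel_left, norm_smul,
      Real.norm_eq_abs, abs_of_pos ht]
    exact mul_le_mul_iff_right₀ ht
  have h2 := setLIntegral_map (μ := volume) (s := Metric.closedBall x (t * r))
    Metric.isClosed_closedBall.measurableSet hF hmeas
  rw [hpre, hmap, Measure.restrict_smul, lintegral_smul_measure] at h2
  rw [← h2, smul_eq_mul, ← mul_assoc, ← ENNReal.ofReal_mul (by positivity),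
    abs_of_pos (by positivity), mul_inv_cancel₀ (by positivity)]
  simp

theorem measurable_rieszKernel {n : ℕ} (α : ℝ) (x : EuclideanSpace ℝ (Fin n)) :
    Measurable fun y => ENNReal.ofReal (‖x - y‖ ^ α) := by
  fun_prop

/-- Translation and dilation reduce to the unit ball, where the kernel is integrable because `γ - n
> -n`. -/
theorem exists_setLIntegral_rieszKernel_le {n : ℕ} (hn : 1 ≤ n) {γ : ℝ} (hγ : 0 < γ) :
    ∃ K : ℝ, 0 < K ∧ ∀ (x : EuclideanSpace ℝ (Fin n)) (R : ℝ), 0 < R →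
      ∫⁻ y in Metric.closedBall x R, ENNReal.ofReal (‖x - y‖ ^ (γ - n)) ≤
        ENNReal.ofReal (K * R ^ γ) := by
  set I : ℝ≥0∞ := ∫⁻ z in Metric.closedBall (0 : EuclideanSpace ℝ (Fin n)) 1,
    ENNReal.ofReal (‖z‖ ^ (γ - n)) with hI
  have hIfin : I < ∞ := by
    have h : IntegrableOn (fun z : EuclideanSpace ℝ (Fin n) => ‖z‖ ^ (γ - n))
        (Metric.ball 0 2) volume := by
      apply integrableOn_ball_of_norm_le_rpow (C := 1) (α := n - γ) (by simpa using hn)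
        (by simpa using hγ)
      · filter_upwards with z
        rw [Real.norm_eq_abs, abs_of_nonneg (by positivity), neg_sub, one_mul]
      · exact (measurable_norm.pow_const _).aestronglyMeasurable
    have h2 := (h.mono_set (Metric.closedBall_subset_ball (show (1 : ℝ) < 2 by norm_num))).2
    rw [hasFiniteIntegral_iff_ofReal (by filter_upwards with z; positivity)] at h2
    exact h2
  refine ⟨I.toReal + 1, by positivity, fun x R hR => ?_⟩
  have h1 := setLIntegral_closedBall_comp_dilation x hR 1 (measurable_rieszKernel (γ - n) x)
  rw [mul_one] at h1
  have h2 : ∀ z : EuclideanSpace ℝ (Fin n),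
      ENNReal.ofReal (‖x - (x + R • (z - x))‖ ^ (γ - n)) =
        ENNReal.ofReal (R ^ (γ - n)) * ENNReal.ofReal (‖z - x‖ ^ (γ - n)) := by
    intro z
    rw [sub_add_cancel_left, norm_neg, norm_smul, Real.norm_eq_abs, abs_of_pos hR,
      Real.mul_rpow hR.le (norm_nonneg _), ENNReal.ofReal_mul (by positivity)]
  simp_rw [h2] at h1
  rw [lintegral_const_mul _ (by fun_prop), ← mul_assoc, ← ENNReal.ofReal_mul (by positivity),
    ← Real.rpow_natCast, ← Real.rpow_add hR, add_sub_cancel] at h1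
  have h3 : ∫⁻ z in Metric.closedBall x 1, ENNReal.ofReal (‖z - x‖ ^ (γ - n)) = I := by
    have h4 := (measurePreserving_sub_right (volume : Measure (EuclideanSpace ℝ (Fin n)))
      x).setLIntegral_comp_preimage (s := Metric.closedBall 0 1)
      Metric.isClosed_closedBall.measurableSet
      (f := fun z => ENNReal.ofReal (‖z‖ ^ (γ - n))) (by fun_prop)
    rw [hI, ← h4]
    congr 2
    ext z; simp [dist_eq_norm]
  rw [← h1, h3, ← ENNReal.ofReal_toReal hIfin.ne, ← ENNReal.ofReal_mul (by positivity)]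
  apply ENNReal.ofReal_le_ofReal
  rw [mul_comm]
  gcongr
  rw [ENNReal.toReal_ofReal ENNReal.toReal_nonneg]
  linarith

theorem ENNReal.rpow_sum_le_sum_rpow_of_le_one {ι : Type*} (F : Finset ι) (a : ι → ℝ≥0∞) {s : ℝ}
    (hs : 0 < s) (hs1 : s ≤ 1) : (∑ i ∈ F, a i) ^ s ≤ ∑ i ∈ F, a i ^ s := by
  classical
  induction F using Finset.induction_on with
  | empty => simp [hs]
  | insert i F hi ih =>
    rw [Finset.sum_insert hi, Finset.sum_insert hi]
    exact (ENNReal.rpow_add_le_add_rpow _ _ hs.le hs1).trans (by gcongr)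

theorem ENNReal.rpow_tsum_le_tsum_rpow_of_le_one {ι : Type*} (a : ι → ℝ≥0∞) {s : ℝ}
    (hs : 0 < s) (hs1 : s ≤ 1) : (∑' i, a i) ^ s ≤ ∑' i, a i ^ s := by
  rw [← ENNReal.le_rpow_inv_iff hs, ENNReal.tsum_eq_iSup_sum]
  refine iSup_le fun F => ?_
  rw [ENNReal.le_rpow_inv_iff hs]
  exact (ENNReal.rpow_sum_le_sum_rpow_of_le_one F a hs hs1).trans (ENNReal.sum_le_tsum F)

/-- Among the sets of given measure for the Riesz kernel of order `γ`, balls essentially minimise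
the integral of the Riesz kernel of order `γ * s`. -/
theorem rpow_setLIntegral_rieszKernel_le {n : ℕ} (hn : 1 ≤ n) {γ s : ℝ} (hγ : 0 < γ)
    (hs : 1 ≤ s) :
    ∃ K : ℝ, 0 < K ∧ ∀ (x : EuclideanSpace ℝ (Fin n)) (A : Set (EuclideanSpace ℝ (Fin n))),
      MeasurableSet A →
      (∫⁻ y in A, ENNReal.ofReal (‖x - y‖ ^ (γ - n))) ^ s ≤
        ENNReal.ofReal K * ∫⁻ y in A, ENNReal.ofReal (‖x - y‖ ^ (γ * s - n)) := by
  obtain ⟨K, hK, hker⟩ := exists_setLIntegral_rieszKernel_le hn hγ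
  have hs0 : 0 < s := by linarith
  refine ⟨(K + 1) ^ s, by positivity, fun x A hA => ?_⟩
  set m := ∫⁻ y in A, ENNReal.ofReal (‖x - y‖ ^ (γ - n)) with hm
  set N := ∫⁻ y in A, ENNReal.ofReal (‖x - y‖ ^ (γ * s - n)) with hN
  -- Split `A` at distance `R` from `x`. Far away, `|x - y|^{γ - γ s} ≤ R^{γ - γ s}` because `s ≥
  -- 1`.
  have key : ∀ R : ℝ, 0 < R →
      m ≤ ENNReal.ofReal (K * R ^ γ) + ENNReal.ofReal (R ^ (γ - γ * s)) * N := by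
    intro R hR
    rw [hm, ← lintegral_inter_add_sdiff _ A (Metric.isClosed_closedBall (x := x)
      (ε := R)).measurableSet]
    gcongr
    · exact (lintegral_mono_set inter_subset_right).trans (hker x R hR)
    · rw [hN, ← lintegral_const_mul _ (measurable_rieszKernel _ x)]
      refine le_trans ?_ (lintegral_mono_set (sdiff_subset (t := Metric.closedBall x R)))
      refine setLIntegral_mono ((measurable_rieszKernel _ x).const_mul _) fun y hy => ?_
      have hy2 : R < ‖x - y‖ := by
        have := hy.2
        rwa [Metric.mem_closedBall', dist_eq_norm, not_le] at this
      have hpos := hR.trans hy2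
      rw [← ENNReal.ofReal_mul (by positivity)]
      apply ENNReal.ofReal_le_ofReal
      have e : γ - n = (γ - γ * s) + (γ * s - n) := by ring
      rw [e, Real.rpow_add hpos]
      gcongr ?_ * _
      exact Real.rpow_le_rpow_of_nonpos hR hy2.le (by nlinarith)
  rcases eq_or_ne N ∞ with hNt | hNt
  · rw [hNt, ENNReal.mul_top (by simpa using by positivity)]
    exact le_top
  -- The kernel is positive off `x`, and `{x}` is null since `n ≥ 1`; hence `N = 0` forces `m = 0`.
  rcases eq_or_ne N 0 with hN0 | hN0
  · have h0 : m = 0 := by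
      have h1 : (fun y => ENNReal.ofReal (‖x - y‖ ^ (γ * s - n))) =ᵐ[volume.restrict A] 0 :=
        (lintegral_eq_zero_iff (measurable_rieszKernel _ x)).1 hN0
      have hne : ∀ᵐ y ∂(volume.restrict A), y ≠ x := by
        have : Nonempty (Fin n) := ⟨⟨0, hn⟩⟩
        exact ae_restrict_of_ae (Measure.ae_ne volume x)
      rw [hm, lintegral_eq_zero_iff (measurable_rieszKernel _ x)]
      filter_upwards [h1, hne] with y hy hyx
      have : 0 < ‖x - y‖ := norm_pos_iff.2 (sub_ne_zero.2 hyx.symm)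
      have h3 : 0 < ‖x - y‖ ^ (γ * s - n) := by positivity
      simp only [Pi.zero_apply, ENNReal.ofReal_eq_zero] at hy
      linarith
    rw [h0, ENNReal.zero_rpow_of_pos hs0]
    exact zero_le
  set ν := N.toReal with hν
  have hν0 : 0 < ν := ENNReal.toReal_pos hN0 hNt
  have hNν : N = ENNReal.ofReal ν := (ENNReal.ofReal_toReal hNt).symm
  -- This radius balances the two terms: both become multiples of `ν^{1/s}`.
  have h1 := key (ν ^ (1 / (γ * s))) (by positivity)
  rw [hNν, ← ENNReal.ofReal_mul (by positivity), ← ENNReal.ofReal_add (by positivity)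
    (by positivity), ← Real.rpow_mul hν0.le, ← Real.rpow_mul hν0.le] at h1
  have e1 : 1 / (γ * s) * γ = 1 / s := by field_simp
  have e2 : 1 / (γ * s) * (γ - γ * s) + 1 = 1 / s := by field_simp; ring
  have e3 : ν ^ (1 / (γ * s) * (γ - γ * s)) * ν = ν ^ (1 / s) := by
    rw [← e2, Real.rpow_add hν0, Real.rpow_one]
  rw [e1, e3] at h1
  calc m ^ s ≤ (ENNReal.ofReal (K * ν ^ (1 / s) + ν ^ (1 / s))) ^ s := by gcongr
    _ = ENNReal.ofReal ((K + 1) ^ s) * N := by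
      rw [ENNReal.ofReal_rpow_of_nonneg (by positivity) hs0.le, hNν,
        ← ENNReal.ofReal_mul (by positivity), ← add_one_mul,
        Real.mul_rpow (by positivity) (by positivity), ← Real.rpow_mul hν0.le,
        one_div_mul_cancel hs0.ne', Real.rpow_one]

/-! ### `A₁` weights against averages over balls. -/

theorem volume_cube {n : ℕ} (a : EuclideanSpace ℝ (Fin n)) {l : ℝ} (hl : 0 < l) :
    volume (cube a l) = ENNReal.ofReal (l ^ n) := by
  have h : cube a l = (WithLp.ofLp : EuclideanSpace ℝ (Fin n) → (Fin n → ℝ)) ⁻¹'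
      Icc (WithLp.ofLp a) (fun i => a i + l) := by
    ext x
    simp only [cube, mem_ofPred_eq, mem_preimage, mem_Icc, Pi.le_def, forall_and]
  rw [h, (PiLp.volume_preserving_ofLp (Fin n)).measure_preimage
    measurableSet_Icc.nullMeasurableSet, Real.volume_Icc_pi]
  simp [ENNReal.ofReal_pow hl.le]

/-- The usable form of the `A₁` condition: almost every value of `ω` on a cube bounds its mean
there, up to the constant. -/
theorem IsMuckenhouptA1.ae_setLIntegral_cube_le {n : ℕ} {ω : EuclideanSpace ℝ (Fin n) → ℝ}
    (hω : IsMuckenhouptA1 ω) (a : EuclideanSpace ℝ (Fin n)) {l : ℝ} (hl : 0 < l) :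
    ∀ᵐ x ∂(volume.restrict (cube a l)), ∫⁻ y in cube a l, ENNReal.ofReal (ω y) ≤
      muckenhouptA1Const ω * ENNReal.ofReal (l ^ n) * ENNReal.ofReal (ω x) := by
  have hT : essSup (fun x => (ENNReal.ofReal (ω x))⁻¹) (volume.restrict (cube a l)) /
      ENNReal.ofReal (l ^ n) * ∫⁻ x in cube a l, ENNReal.ofReal (ω x) ≤ muckenhouptA1Const ω := by
    rw [← volume_cube a hl]
    exact le_iSup_of_le a (le_iSup₂_of_le l hl le_rfl)
  have hV0 : ENNReal.ofReal (l ^ n) ≠ 0 := by simpa using by positivity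
  filter_upwards [ENNReal.ae_le_essSup (μ := volume.restrict (cube a l))
    (fun x => (ENNReal.ofReal (ω x))⁻¹)] with x hx
  have h1 : (ENNReal.ofReal (ω x))⁻¹ * ∫⁻ y in cube a l, ENNReal.ofReal (ω y) ≤
      muckenhouptA1Const ω * ENNReal.ofReal (l ^ n) := by
    rw [← ENNReal.div_le_iff hV0 ENNReal.ofReal_ne_top]
    refine le_trans ?_ hT
    rw [ENNReal.mul_div_right_comm]
    gcongr
  have h2 : muckenhouptA1Const ω * ENNReal.ofReal (l ^ n) ≠ ∞ :=
    ENNReal.mul_ne_top hω.const_lt_top.ne ENNReal.ofReal_ne_top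
  -- Where `ω` vanishes its inverse is `∞`, so finiteness of the constant forces the integral over
  -- the cube to be zero.
  rcases eq_or_ne (ENNReal.ofReal (ω x)) 0 with h0 | h0
  · rw [h0, ENNReal.inv_zero] at h1
    have : ∫⁻ y in cube a l, ENNReal.ofReal (ω y) = 0 := by
      by_contra h
      rw [ENNReal.top_mul h] at h1
      exact h2 (top_le_iff.1 h1)
    rw [this]; exact zero_le
  · rw [mul_comm, ← div_eq_mul_inv, ENNReal.div_le_iff h0 ENNReal.ofReal_ne_top] at h1
    exact h1

/-- Enclose the large ball in a cube of edge `2 * R`, multiply the almost everywhere bound by `F`,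
and integrate over the small ball. -/
theorem IsMuckenhouptA1.setLIntegral_closedBall_mul_le {n : ℕ}
    {ω : EuclideanSpace ℝ (Fin n) → ℝ} (hω : IsMuckenhouptA1 ω)
    (c : EuclideanSpace ℝ (Fin n)) {ρ R : ℝ} (hρ : 0 < ρ) (hR : ρ ≤ R)
    (F : EuclideanSpace ℝ (Fin n) → ℝ≥0∞) (hF : Measurable F) :
    (∫⁻ x in Metric.closedBall c R, ENNReal.ofReal (ω x)) * ∫⁻ x in Metric.closedBall c ρ, F x ≤
      muckenhouptA1Const ω * ENNReal.ofReal ((2 * R) ^ n) *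
        ∫⁻ x in Metric.closedBall c ρ, F x * ENNReal.ofReal (ω x) := by
  set a : EuclideanSpace ℝ (Fin n) := WithLp.toLp 2 (fun i => c i - R) with ha
  have hsub : Metric.closedBall c R ⊆ cube a (2 * R) := by
    intro x hx i
    have h1 : ‖(x - c) i‖ ≤ R := (PiLp.norm_apply_le (x - c) i).trans
      (by simpa [dist_eq_norm] using hx)
    rw [PiLp.sub_apply, Real.norm_eq_abs, abs_le] at h1
    simp only [ha, mem_Icc]
    constructor <;> linarith
  have hωm : AEMeasurable (fun x => ENNReal.ofReal (ω x)) volume :=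
    hω.locallyIntegrable.aestronglyMeasurable.aemeasurable.ennreal_ofReal
  have hR0 : 0 < 2 * R := by linarith
  have hae := hω.ae_setLIntegral_cube_le a hR0
  have hae2 := ae_restrict_of_ae_restrict_of_subset
    ((Metric.closedBall_subset_closedBall hR).trans hsub) hae
  rw [← lintegral_const_mul _ hF, ← lintegral_const_mul'' _
    (show AEMeasurable (fun x => F x * ENNReal.ofReal (ω x)) _ from
      hF.aemeasurable.mul hωm.restrict)]
  refine lintegral_mono_ae ?_
  filter_upwards [hae2] with x hx
  calc _ ≤ (∫⁻ x in cube a (2 * R), ENNReal.ofReal (ω x)) * F x := by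
        gcongr
    _ ≤ _ := by
      refine (mul_le_mul_left hx (F x)).trans_eq ?_
      ring

theorem rpow_setLIntegral_le {α : Type*} [MeasurableSpace α] {μ : Measure α} {G : α → ℝ≥0∞}
    (hG : Measurable G) (s : Set α) {p : ℝ} (hp : 1 ≤ p) :
    (∫⁻ x in s, G x ∂μ) ^ p ≤ μ s ^ (p - 1) * ∫⁻ x in s, G x ^ p ∂μ := by
  have hp0 : 0 < p := by linarith
  have h := eLpNorm'_le_eLpNorm'_mul_rpow_measure_univ (μ := μ.restrict s) one_pos hp
    hG.aestronglyMeasurable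
  simp only [eLpNorm'_eq_lintegral_enorm, enorm_eq_self, ENNReal.rpow_one, div_one,
    Measure.restrict_apply_univ] at h
  calc _ ≤ ((∫⁻ x in s, G x ^ p ∂μ) ^ (1 / p) * μ s ^ (1 - 1 / p)) ^ p := by gcongr
    _ = _ := by
      rw [ENNReal.mul_rpow_of_nonneg _ _ hp0.le, ← ENNReal.rpow_mul, ← ENNReal.rpow_mul,
        one_div_mul_cancel hp0.ne', ENNReal.rpow_one, mul_comm]
      congr 2
      field_simp

/-- The volume of the unit ball of `ℝⁿ`. -/
noncomputable def unitBallVolume (n : ℕ) : ℝ :=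
  (volume (Metric.closedBall (0 : EuclideanSpace ℝ (Fin n)) 1)).toReal

theorem unitBallVolume_pos (n : ℕ) : 0 < unitBallVolume n :=
  ENNReal.toReal_pos (Metric.measure_closedBall_pos volume _ one_pos).ne'
    measure_closedBall_lt_top.ne

theorem volume_closedBall_eq {n : ℕ} (c : EuclideanSpace ℝ (Fin n)) {r : ℝ} (hr : 0 ≤ r) :
    volume (Metric.closedBall c r) = ENNReal.ofReal (r ^ n * unitBallVolume n) := by
  rw [Measure.addHaar_closedBall' volume c hr, unitBallVolume,
    ENNReal.ofReal_mul (by positivity), ENNReal.ofReal_toReal measure_closedBall_lt_top.ne]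
  simp

/-- If `F` has average at least `A` over a ball, an `A₁`-weight controls `A ^ p` times the mass of
a dilated ball. -/
theorem IsMuckenhouptA1.rpow_mul_setLIntegral_le {n : ℕ}
    {ω : EuclideanSpace ℝ (Fin n) → ℝ} (hω : IsMuckenhouptA1 ω) {p : ℝ} (hp : 1 ≤ p)
    {G : EuclideanSpace ℝ (Fin n) → ℝ≥0∞} (hG : Measurable G)
    {c : EuclideanSpace ℝ (Fin n)} {ρ L A : ℝ} (hρ : 0 < ρ) (hL : 1 ≤ L) (hA : 0 ≤ A)
    (h : ENNReal.ofReal A * volume (Metric.closedBall c ρ) ≤ ∫⁻ x in Metric.closedBall c ρ, G x) :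
    ENNReal.ofReal (A ^ p) * ∫⁻ x in Metric.closedBall c (L * ρ), ENNReal.ofReal (ω x) ≤
      muckenhouptA1Const ω * ENNReal.ofReal ((2 * L) ^ n / unitBallVolume n) *
        ∫⁻ x in Metric.closedBall c ρ, G x ^ p * ENNReal.ofReal (ω x) := by
  have hp0 : 0 < p := by linarith
  set V := volume (Metric.closedBall c ρ) with hV
  have hV0 : V ≠ 0 := (Metric.measure_closedBall_pos volume _ hρ).ne'
  have hVt : V ≠ ∞ := measure_closedBall_lt_top.ne
  set W := ∫⁻ x in Metric.closedBall c (L * ρ), ENNReal.ofReal (ω x)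
  set J := ∫⁻ x in Metric.closedBall c ρ, G x ^ p * ENNReal.ofReal (ω x)
  set I := ∫⁻ x in Metric.closedBall c ρ, G x ^ p
  have h1 : ENNReal.ofReal (A ^ p) * V ≤ I := by
    have h2 := (ENNReal.rpow_le_rpow h hp0.le).trans
      (rpow_setLIntegral_le hG (Metric.closedBall c ρ) hp)
    have e : V ^ p = V ^ (p - 1) * V := by
      conv_rhs => rw [← ENNReal.rpow_one V, ← ENNReal.rpow_mul, one_mul]
      rw [← ENNReal.rpow_add _ _ hV0 hVt, sub_add_cancel]
    rw [ENNReal.mul_rpow_of_nonneg _ _ hp0.le, e, ENNReal.ofReal_rpow_of_nonneg hA hp0.le,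
      mul_left_comm] at h2
    refine (ENNReal.mul_le_mul_iff_right ?_ ?_).1 h2
    · exact (ENNReal.rpow_pos (pos_iff_ne_zero.2 hV0) hVt).ne'
    · exact ENNReal.rpow_ne_top_of_nonneg (by linarith) hVt
  have h3 : W * I ≤ muckenhouptA1Const ω * ENNReal.ofReal ((2 * (L * ρ)) ^ n) * J :=
    hω.setLIntegral_closedBall_mul_le c hρ (by nlinarith) _ (hG.pow_const p)
  -- The factor `V` is carried to turn `(2 * L * ρ)^n` into the scale-free constant, and is
  -- cancelled at the end.
  have h4 : V * (ENNReal.ofReal (A ^ p) * W) ≤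
      V * (muckenhouptA1Const ω * ENNReal.ofReal ((2 * L) ^ n / unitBallVolume n) * J) := by
    calc V * (ENNReal.ofReal (A ^ p) * W) = W * (ENNReal.ofReal (A ^ p) * V) := by ring
      _ ≤ W * I := by gcongr
      _ ≤ _ := h3
      _ = muckenhouptA1Const ω * (ENNReal.ofReal ((2 * L) ^ n / unitBallVolume n) * V) * J := by
        have := unitBallVolume_pos n
        rw [hV, volume_closedBall_eq c hρ.le, ← ENNReal.ofReal_mul (by positivity)]
        congr 3
        field_simp
        ring
      _ = _ := by ring
  exact (ENNReal.mul_le_mul_iff_right hV0 hVt).1 h4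

/-! ### Oscillation of `f` and dyadic averages of its gradient. -/

theorem continuous_gradNorm {n : ℕ} {𝕜 : Type*} [RCLike 𝕜] {f : EuclideanSpace ℝ (Fin n) → 𝕜}
    (hf : ContDiff ℝ 1 f) : Continuous (gradNorm f) := by
  have := hf.continuous_fderiv one_ne_zero
  unfold gradNorm
  fun_prop

theorem norm_fderiv_apply_le_gradNorm_mul {n : ℕ} {𝕜 : Type*} [RCLike 𝕜]
    (f : EuclideanSpace ℝ (Fin n) → 𝕜) (x v : EuclideanSpace ℝ (Fin n)) :
    ‖fderiv ℝ f x v‖ ≤ gradNorm f x * ‖v‖ := by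
  have h1 : v = ∑ j, v j • EuclideanSpace.single j (1 : ℝ) := by
    conv_lhs => rw [← (EuclideanSpace.basisFun (Fin n) ℝ).sum_repr v]
    simp
  calc ‖fderiv ℝ f x v‖ = ‖∑ j, v j • fderiv ℝ f x (EuclideanSpace.single j 1)‖ := by
        conv_lhs => rw [h1]
        simp [map_sum]
    _ ≤ ∑ j, ‖fderiv ℝ f x (EuclideanSpace.single j 1)‖ * ‖v j‖ := by
        refine (norm_sum_le _ _).trans_eq ?_
        simp [norm_smul, mul_comm]
    _ ≤ gradNorm f x * ‖v‖ := by
        rw [gradNorm, EuclideanSpace.norm_eq]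
        exact Real.sum_mul_le_sqrt_mul_sqrt _ _ _

theorem enorm_sub_le_lintegral_gradNorm {n : ℕ} {𝕜 : Type*} [RCLike 𝕜]
    {f : EuclideanSpace ℝ (Fin n) → 𝕜} (hf : ContDiff ℝ 1 f) (x z : EuclideanSpace ℝ (Fin n)) :
    ‖f z - f x‖ₑ ≤
      ‖z - x‖ₑ * ∫⁻ t in Ioc (0 : ℝ) 1, ENNReal.ofReal (gradNorm f (x + t • (z - x))) := by
  have hg := continuous_gradNorm hf
  set φ : ℝ → 𝕜 := fun t => f (x + t • (z - x)) with hφ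
  have hφc : ContDiff ℝ 1 φ := hf.comp (by fun_prop)
  have h1 := enorm_sub_le_lintegral_deriv_of_contDiffOn_Icc (hφc.contDiffOn (s := Icc 0 1))
    zero_le_one
  simp only [hφ, one_smul, add_sub_cancel, zero_smul, add_zero] at h1
  refine h1.trans ?_
  rw [restrict_Ioc_eq_restrict_Icc, ← lintegral_const_mul _ (by fun_prop)]
  refine lintegral_mono fun t => ?_
  have hd : HasDerivAt φ (fderiv ℝ f (x + t • (z - x)) (z - x)) t := by
    have h2 : HasDerivAt (fun t : ℝ => x + t • (z - x)) (z - x) t := by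
      simpa using ((hasDerivAt_id t).smul_const (z - x)).const_add x
    exact (((hf.differentiable one_ne_zero) _).hasFDerivAt.comp_hasDerivAt t h2)
  rw [hd.deriv, mul_comm, ← ofReal_norm, ← ofReal_norm,
    ← ENNReal.ofReal_mul (show 0 ≤ gradNorm f _ from Real.sqrt_nonneg _)]
  exact ENNReal.ofReal_le_ofReal (norm_fderiv_apply_le_gradNorm_mul f _ _)

theorem lintegral_rpow_neg_Ioc {a : ℝ} (ha : a < 1) :
    ∫⁻ t in Ioc (0 : ℝ) 1, ENNReal.ofReal (t ^ (-a)) = ENNReal.ofReal (1 / (1 - a)) := by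
  have hi : IntervalIntegrable (fun t : ℝ => t ^ (-a)) volume 0 1 :=
    intervalIntegral.intervalIntegrable_rpow' (by linarith)
  rw [← ofReal_integral_eq_lintegral_ofReal, ← intervalIntegral.integral_of_le zero_le_one,
    integral_rpow (Or.inl (by linarith))]
  · rw [Real.one_rpow, Real.zero_rpow (by linarith)]
    congr 1; ring
  · exact (intervalIntegrable_iff_integrableOn_Ioc_of_le zero_le_one).1 hi
  · filter_upwards [self_mem_ae_restrict measurableSet_Ioc] with t ht
    exact Real.rpow_nonneg ht.1.le _

/-- Control of the mean oscillation around the centre of a ball by the dyadic averages of the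
gradient. -/
theorem setLIntegral_enorm_sub_le {n : ℕ} {𝕜 : Type*} [RCLike 𝕜]
    {f : EuclideanSpace ℝ (Fin n) → 𝕜} (hf : ContDiff ℝ 1 f) {a M r : ℝ} (ha0 : 0 ≤ a)
    (ha : a < 1) (hM : 0 ≤ M) (hr : 0 < r) (x : EuclideanSpace ℝ (Fin n))
    (h : ∀ j : ℕ, ∫⁻ z in Metric.closedBall x ((1 / 2) ^ j * r), ENNReal.ofReal (gradNorm f z) ≤
      ENNReal.ofReal (M * 2 ^ (j * a)) * volume (Metric.closedBall x ((1 / 2) ^ j * r))) :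
    ∫⁻ z in Metric.closedBall x r, ‖f z - f x‖ₑ ≤
      ENNReal.ofReal (r * (2 ^ n * M / (1 - a))) * volume (Metric.closedBall x r) := by
  have hg := continuous_gradNorm hf
  have hv := unitBallVolume_pos n
  have step : ∀ t ∈ Ioc (0 : ℝ) 1,
      ∫⁻ z in Metric.closedBall x r, ENNReal.ofReal (gradNorm f (x + t • (z - x))) ≤
        ENNReal.ofReal (2 ^ n * M * (r ^ n * unitBallVolume n)) * ENNReal.ofReal (t ^ (-a)) := by
    rintro t ⟨ht0, ht1⟩
    -- Choose `j` with `2^{-(j+1)} < t ≤ 2^{-j}`. Enlarging the ball of radius `t * r` to radius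
    -- `2^{-j} r` costs `2^n`, and `2^{ja} ≤ t^{-a}`, which is integrable on `(0, 1]`.
    obtain ⟨j, hj1, hj2⟩ := exists_nat_pow_near_of_lt_one ht0 ht1
      (show (0 : ℝ) < 1 / 2 by norm_num) (by norm_num)
    have h1 := setLIntegral_closedBall_comp_dilation x ht0 r
      (F := fun z => ENNReal.ofReal (gradNorm f z)) (by fun_prop)
    have h2 : ∫⁻ w in Metric.closedBall x (t * r), ENNReal.ofReal (gradNorm f w) ≤ _ :=
      (lintegral_mono_set (Metric.closedBall_subset_closedBall (by gcongr))).trans (h j)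
    rw [← h1, volume_closedBall_eq x (by positivity), ← ENNReal.ofReal_mul (by positivity)] at h2
    have htn : ENNReal.ofReal (t ^ n) ≠ 0 := by simpa using by positivity
    refine (ENNReal.mul_le_mul_iff_right htn ENNReal.ofReal_ne_top).1 (h2.trans ?_)
    rw [← ENNReal.ofReal_mul (by positivity), ← ENNReal.ofReal_mul (by positivity)]
    apply ENNReal.ofReal_le_ofReal
    have e1 : (2 : ℝ) ^ (j * a) ≤ t ^ (-a) := by
      have : (2 : ℝ) ^ ((j : ℝ) * a) = ((1 / 2 : ℝ) ^ j) ^ (-a) := by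
        rw [one_div, ← Real.rpow_natCast, ← Real.rpow_mul (by norm_num),
          Real.inv_rpow (by norm_num), ← Real.rpow_neg (by norm_num)]
        congr 1; ring
      rw [this]
      exact Real.rpow_le_rpow_of_nonpos ht0 hj2 (by linarith)
    have e2 : ((1 / 2 : ℝ) ^ j) ^ n ≤ (2 * t) ^ n := by
      rw [pow_succ] at hj1
      gcongr; linarith
    calc M * 2 ^ (j * a) * (((1 / 2) ^ j * r) ^ n * unitBallVolume n)
        = M * 2 ^ (j * a) * (((1 / 2) ^ j) ^ n * (r ^ n * unitBallVolume n)) := by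
          rw [mul_pow]; ring
      _ ≤ M * t ^ (-a) * ((2 * t) ^ n * (r ^ n * unitBallVolume n)) := by gcongr
      _ = _ := by rw [mul_pow]; ring
  calc ∫⁻ z in Metric.closedBall x r, ‖f z - f x‖ₑ
      ≤ ∫⁻ z in Metric.closedBall x r, ENNReal.ofReal r *
          ∫⁻ t in Ioc (0 : ℝ) 1, ENNReal.ofReal (gradNorm f (x + t • (z - x))) := by
        refine setLIntegral_mono' Metric.isClosed_closedBall.measurableSet fun z hz => ?_
        refine (enorm_sub_le_lintegral_gradNorm hf x z).trans ?_
        gcongr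
        rw [← ofReal_norm]
        exact ENNReal.ofReal_le_ofReal (by simpa [dist_eq_norm] using hz)
    _ = ENNReal.ofReal r * ∫⁻ t in Ioc (0 : ℝ) 1, ∫⁻ z in Metric.closedBall x r,
          ENNReal.ofReal (gradNorm f (x + t • (z - x))) := by
        rw [lintegral_const_mul' _ _ ENNReal.ofReal_ne_top, lintegral_lintegral_swap]
        have : Continuous fun w : EuclideanSpace ℝ (Fin n) × ℝ =>
            gradNorm f (x + w.2 • (w.1 - x)) := by fun_prop
        exact this.measurable.ennreal_ofReal.aemeasurable
    _ ≤ ENNReal.ofReal r * ∫⁻ t in Ioc (0 : ℝ) 1,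
          ENNReal.ofReal (2 ^ n * M * (r ^ n * unitBallVolume n)) * ENNReal.ofReal (t ^ (-a)) := by
        exact mul_le_mul_right (setLIntegral_mono' measurableSet_Ioc step) _
    _ = _ := by
        have : 0 < 1 - a := by linarith
        rw [lintegral_const_mul' _ _ ENNReal.ofReal_ne_top, lintegral_rpow_neg_Ioc ha,
          volume_closedBall_eq x hr.le, ← ENNReal.ofReal_mul (by positivity),
          ← ENNReal.ofReal_mul (by positivity), ← ENNReal.ofReal_mul (by positivity)]
        congr 1; ring

/-- If the difference quotient of `f` at `(x, y)` is large, so is the average of the gradient over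
some dyadic ball centred at `x` or at `y`. -/
theorem exists_lt_setLIntegral_gradNorm {n : ℕ} {𝕜 : Type*} [RCLike 𝕜]
    {f : EuclideanSpace ℝ (Fin n) → 𝕜} (hf : ContDiff ℝ 1 f) {a M r : ℝ} (ha0 : 0 ≤ a)
    (ha : a < 1) (hM : 0 ≤ M) {x y : EuclideanSpace ℝ (Fin n)} (hxy : x ≠ y) (hr : r = ‖x - y‖)
    (h : r * (2 ^ (2 * n + 1) * M / (1 - a)) < ‖f x - f y‖) :
    ∃ j : ℕ, ∃ w, (w = x ∨ w = y) ∧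
      ENNReal.ofReal (M * 2 ^ (j * a)) * volume (Metric.closedBall w ((1 / 2) ^ j * r)) <
        ∫⁻ z in Metric.closedBall w ((1 / 2) ^ j * r), ENNReal.ofReal (gradNorm f z) := by
  by_contra! hcon
  have hr0 : 0 < r := hr ▸ norm_pos_iff.2 (sub_ne_zero.2 hxy)
  have h1a : 0 < 1 - a := by linarith
  have hv := unitBallVolume_pos n
  have hfc := hf.continuous
  have hx := setLIntegral_enorm_sub_le hf ha0 ha hM hr0 x fun j => hcon j x (Or.inl rfl)
  have hy := setLIntegral_enorm_sub_le hf ha0 ha hM hr0 y fun j => hcon j y (Or.inr rfl)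
  -- Compare `f x` and `f y` through the values on `W`, which lies in both balls of radius `r`. In
  -- `2^{2n+1}`, one `2^n` comes from the oscillation bound, one from the volume ratio, and the `2`
  -- from the two centres.
  set W := Metric.closedBall (midpoint ℝ x y) (r / 2) with hW
  have hd : dist x y = r := by rw [hr, dist_eq_norm]
  have hWx : W ⊆ Metric.closedBall x r := by
    refine Metric.closedBall_subset_closedBall' ?_
    rw [dist_midpoint_left, hd]; norm_num; linarith
  have hWy : W ⊆ Metric.closedBall y r := by
    refine Metric.closedBall_subset_closedBall' ?_
    rw [dist_midpoint_right, hd]; norm_num; linarith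
  have h3 : ‖f x - f y‖ₑ * volume W ≤
      (∫⁻ z in W, ‖f z - f x‖ₑ) + ∫⁻ z in W, ‖f z - f y‖ₑ := by
    rw [← setLIntegral_const, ← lintegral_add_left (by fun_prop)]
    refine lintegral_mono fun z => ?_
    rw [← enorm_neg (f z - f x), neg_sub]
    refine le_trans (le_of_eq ?_) (enorm_add_le _ _)
    congr 1; ring
  have h4 := h3.trans (add_le_add ((lintegral_mono_set hWx).trans hx)
    ((lintegral_mono_set hWy).trans hy))
  rw [volume_closedBall_eq x hr0.le, volume_closedBall_eq y hr0.le, hW,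
    volume_closedBall_eq _ (by positivity), ← ofReal_norm,
    ← ENNReal.ofReal_mul (by positivity), ← ENNReal.ofReal_mul (by positivity),
    ← ENNReal.ofReal_add (by positivity) (by positivity),
    ENNReal.ofReal_le_ofReal_iff (by positivity)] at h4
  have h5 := mul_lt_mul_of_pos_right h (show 0 < (r / 2) ^ n * unitBallVolume n by positivity)
  refine absurd (h5.trans_le h4) (not_lt.2 (le_of_eq ?_))
  rw [div_pow, pow_succ, mul_comm 2 n, pow_mul]
  field_simp
  norm_num

/-! ### Vitali selection, and the kernel over the pairs attached to one ball. -/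

theorem exists_countable_disjoint_closedBall_cover {n : ℕ}
    (t : Set (EuclideanSpace ℝ (Fin n) × ℝ)) (ht : ∀ z ∈ t, 0 < z.2) {R : ℝ}
    (hR : ∀ z ∈ t, z.2 ≤ R) :
    ∃ u ⊆ t, u.Countable ∧ u.PairwiseDisjoint (fun z => Metric.closedBall z.1 z.2) ∧
      ∀ z ∈ t, ∃ w ∈ u, z.1 ∈ Metric.closedBall w.1 (3 * w.2) ∧ z.2 ≤ 2 * w.2 := by
  obtain ⟨u, hut, hdisj, hcov⟩ := Vitali.exists_disjoint_subfamily_covering_enlargement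
    (fun z : EuclideanSpace ℝ (Fin n) × ℝ => Metric.closedBall z.1 z.2) t (fun z => z.2) 2
    one_lt_two (fun z hz => (ht z hz).le) R hR
    (fun z hz => ⟨z.1, Metric.mem_closedBall_self (ht z hz).le⟩)
  refine ⟨u, hut, ?_, hdisj, fun z hz => ?_⟩
  · refine hdisj.countable_of_nonempty_interior fun z hz => ?_
    exact ⟨z.1, Metric.ball_subset_interior_closedBall (Metric.mem_ball_self (ht z (hut hz)))⟩
  · obtain ⟨w, hw, ⟨v, hv1, hv2⟩, hle⟩ := hcov z hz
    refine ⟨w, hw, ?_, hle⟩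
    simp only [Metric.mem_closedBall] at hv1 hv2 ⊢
    have := dist_triangle_left z.1 w.1 v
    linarith

theorem Real.rpow_le_two_rpow_abs_mul {u A α : ℝ} (hA : 0 < A) (h1 : A ≤ u) (h2 : u ≤ 2 * A) :
    u ^ α ≤ 2 ^ |α| * A ^ α := by
  have hu : 0 < u := hA.trans_le h1
  rcases le_or_gt 0 α with h | h
  · rw [abs_of_nonneg h, ← Real.mul_rpow (by norm_num) hA.le]
    gcongr
  · calc u ^ α ≤ A ^ α := Real.rpow_le_rpow_of_nonpos hA h1 h.le
      _ = 1 * A ^ α := (one_mul _).symm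
      _ ≤ _ := by gcongr; exact Real.one_le_rpow (by norm_num) (abs_nonneg α)

/-- The points `y` within distance `2 ^ (j + 1) * ρ` of `x` such that `x` or `y` lies in the ball
of centre `c` and radius `3 * ρ`. -/
def ballSection {n : ℕ} (j : ℕ) (c : EuclideanSpace ℝ (Fin n)) (ρ : ℝ)
    (x : EuclideanSpace ℝ (Fin n)) : Set (EuclideanSpace ℝ (Fin n)) :=
  {y | (x ∈ Metric.closedBall c (3 * ρ) ∨ y ∈ Metric.closedBall c (3 * ρ)) ∧
    ‖x - y‖ ≤ 2 ^ (j + 1) * ρ}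

/-- A step function dominating the integral of the Riesz kernel over `ballSection`. -/
noncomputable def ballSectionBound {n : ℕ} (K C γ : ℝ) (j : ℕ) (c : EuclideanSpace ℝ (Fin n))
    (ρ : ℝ) (x : EuclideanSpace ℝ (Fin n)) : ℝ≥0∞ :=
  (Metric.closedBall c (4 * ρ)).indicator
      (fun _ => ENNReal.ofReal (K * 2 ^ ((j + 1) * γ) * ρ ^ γ)) x +
    ∑ l ∈ Finset.range (j + 1), (Metric.closedBall c (2 ^ (l + 3) * ρ)).indicator
      (fun _ => ENNReal.ofReal (C * 2 ^ (l * (γ - n)) * ρ ^ γ)) x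

theorem exists_dyadic_between {ρ u : ℝ} (h1 : ρ < u) {j : ℕ}
    (h2 : u ≤ 2 ^ (j + 1) * ρ) : ∃ l < j + 1, 2 ^ l * ρ < u ∧ u ≤ 2 ^ (l + 1) * ρ := by
  classical
  have hex : ∃ m : ℕ, u ≤ 2 ^ m * ρ := ⟨_, h2⟩
  have hspec := Nat.find_spec hex
  have hmin := fun m => Nat.find_min hex (m := m)
  have hle := Nat.find_min' hex h2
  rcases hm : Nat.find hex with _ | l
  · rw [hm] at hspec; norm_num at hspec; linarith
  · rw [hm] at hspec hle
    refine ⟨l, by omega, ?_, hspec⟩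
    exact not_le.1 (hmin l (by omega))

/-- For `x` near `c`, the whole ball about `x` is integrated. For `x` far away, `y` must lie in the
ball of radius `3 * ρ`; on a dyadic shell about `x` the kernel is almost constant, so the volume of
that ball suffices. -/
theorem setLIntegral_ballSection_le {n : ℕ} {γ K : ℝ}
    (hK : ∀ (x : EuclideanSpace ℝ (Fin n)) (R : ℝ), 0 < R →
      ∫⁻ y in Metric.closedBall x R, ENNReal.ofReal (‖x - y‖ ^ (γ - n)) ≤
        ENNReal.ofReal (K * R ^ γ))
    (j : ℕ) (c : EuclideanSpace ℝ (Fin n)) {ρ : ℝ} (hρ : 0 < ρ) (x : EuclideanSpace ℝ (Fin n)) :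
    ∫⁻ y in ballSection j c ρ x, ENNReal.ofReal (‖x - y‖ ^ (γ - n)) ≤
      ballSectionBound K (2 ^ |γ - n| * (3 ^ n * unitBallVolume n)) γ j c ρ x := by
  have hv := unitBallVolume_pos n
  unfold ballSectionBound
  -- The margin between `3 * ρ` and `4 * ρ` gives `|x - y| > ρ` in the far case, so the shells can
  -- start at `l = 0`.
  by_cases hx : x ∈ Metric.closedBall c (4 * ρ)
  · refine le_trans ?_ le_self_add
    rw [indicator_of_mem hx]
    have hsub : ballSection j c ρ x ⊆ Metric.closedBall x (2 ^ (j + 1) * ρ) := by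
      intro y hy
      rw [Metric.mem_closedBall', dist_eq_norm]
      exact hy.2
    refine (lintegral_mono_set hsub).trans ((hK x _ (by positivity)).trans_eq ?_)
    rw [Real.mul_rpow (by positivity) hρ.le, ← Real.rpow_natCast, ← Real.rpow_mul (by norm_num),
      mul_assoc]
    push_cast
    rfl
  · refine le_trans ?_ le_add_self
    set S : ℕ → Set (EuclideanSpace ℝ (Fin n)) := fun l =>
      {y | y ∈ Metric.closedBall c (3 * ρ) ∧ 2 ^ l * ρ < ‖x - y‖ ∧ ‖x - y‖ ≤ 2 ^ (l + 1) * ρ}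
      with hS
    have hsub : ballSection j c ρ x ⊆ ⋃ l : Fin (j + 1), S l := by
      rintro y ⟨hxy, hy⟩
      have hyc : y ∈ Metric.closedBall c (3 * ρ) := by
        refine hxy.resolve_left fun h => hx ?_
        exact Metric.closedBall_subset_closedBall (by linarith) h
      have hlt : ρ < ‖x - y‖ := by
        rw [← dist_eq_norm]
        rw [Metric.mem_closedBall] at hx hyc
        have := dist_triangle x y c
        linarith
      obtain ⟨l, hl, h1, h2⟩ := exists_dyadic_between hlt hy
      exact mem_iUnion.2 ⟨⟨l, hl⟩, hyc, h1, h2⟩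
    refine (lintegral_mono_set hsub).trans ((lintegral_iUnion_le _ _).trans ?_)
    rw [tsum_fintype, Finset.sum_range]
    refine Finset.sum_le_sum fun l _ => ?_
    -- A nonempty shell places `x` within `2^{l+1} ρ + 3 ρ ≤ 2^{l+3} ρ` of `c`, where the indicator
    -- equals one.
    rcases (S l).eq_empty_or_nonempty with he | ⟨y₀, hy₀⟩
    · rw [he]; simp
    have hxmem : x ∈ Metric.closedBall c (2 ^ ((l : ℕ) + 3) * ρ) := by
      have h1 := dist_triangle x y₀ c
      have h2 := hy₀.1
      have h3 := hy₀.2.2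
      rw [Metric.mem_closedBall] at h2 ⊢
      rw [← dist_eq_norm] at h3
      have h4 : (1 : ℝ) ≤ 2 ^ (l : ℕ) := one_le_pow₀ (by norm_num)
      rw [pow_succ] at h3
      rw [pow_add]
      nlinarith
    rw [indicator_of_mem hxmem]
    have hSm : MeasurableSet (S l) := by
      apply MeasurableSet.inter Metric.isClosed_closedBall.measurableSet
      have hm : Measurable fun y => ‖x - y‖ := by fun_prop
      exact (measurableSet_lt measurable_const hm).inter (measurableSet_le hm measurable_const)
    calc ∫⁻ y in S l, ENNReal.ofReal (‖x - y‖ ^ (γ - n))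
        ≤ ∫⁻ y in S l, ENNReal.ofReal (2 ^ |γ - n| * (2 ^ (l : ℕ) * ρ) ^ (γ - n)) := by
          refine setLIntegral_mono' hSm fun y hy => ENNReal.ofReal_le_ofReal ?_
          refine Real.rpow_le_two_rpow_abs_mul (by positivity) hy.2.1.le (hy.2.2.trans_eq ?_)
          ring
      _ ≤ ENNReal.ofReal (2 ^ |γ - n| * (2 ^ (l : ℕ) * ρ) ^ (γ - n)) *
            volume (Metric.closedBall c (3 * ρ)) := by
          rw [setLIntegral_const]
          gcongr
          exact fun y hy => hy.1
      _ = _ := by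
          rw [volume_closedBall_eq c (by positivity), ← ENNReal.ofReal_mul (by positivity),
            Real.mul_rpow (by positivity) hρ.le, ← Real.rpow_natCast 2 l,
            ← Real.rpow_mul (by norm_num), mul_pow]
          congr 1
          have : ρ ^ γ = ρ ^ (γ - n) * ρ ^ n := by
            rw [← Real.rpow_natCast, ← Real.rpow_add hρ, sub_add_cancel]
          rw [this]; ring

theorem measurable_ballSectionBound {n : ℕ} (K C γ : ℝ) (j : ℕ) (c : EuclideanSpace ℝ (Fin n))
    (ρ : ℝ) : Measurable (ballSectionBound K C γ j c ρ) := by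
  unfold ballSectionBound
  refine Measurable.add ?_ (Finset.measurable_fun_sum _ fun l _ => ?_)
  all_goals exact measurable_const.indicator Metric.isClosed_closedBall.measurableSet

/-! ### Weighted estimate for a single ball. -/

/-- The relation `b * p = γ * s` makes `(ρ^γ)^s` equal to `(ρ^b)^p`, so the radius enters only
through the average and drops out of the constant. -/
theorem IsMuckenhouptA1.lintegral_indicator_closedBall_rpow_le {n : ℕ}
    {ω : EuclideanSpace ℝ (Fin n) → ℝ} (hω : IsMuckenhouptA1 ω) {p s b γ κ : ℝ} (hp : 1 ≤ p)
    (hs : 0 < s) (hb : b * p = γ * s) (hκ : 0 ≤ κ)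
    {G : EuclideanSpace ℝ (Fin n) → ℝ≥0∞} (hG : Measurable G)
    {c : EuclideanSpace ℝ (Fin n)} {ρ L d : ℝ} (hρ : 0 < ρ) (hL : 1 ≤ L) (hd : 0 ≤ d)
    (h : ENNReal.ofReal (κ * ρ ^ b) * volume (Metric.closedBall c ρ) ≤
      ∫⁻ x in Metric.closedBall c ρ, G x) :
    ENNReal.ofReal (κ ^ p) * ∫⁻ x, (Metric.closedBall c (L * ρ)).indicator
        (fun _ => ENNReal.ofReal (d * ρ ^ γ)) x ^ s * ENNReal.ofReal (ω x) ≤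
      muckenhouptA1Const ω * ENNReal.ofReal (d ^ s * ((2 * L) ^ n / unitBallVolume n)) *
        ∫⁻ x in Metric.closedBall c ρ, G x ^ p * ENNReal.ofReal (ω x) := by
  have hm := (Metric.isClosed_closedBall (x := c) (ε := L * ρ)).measurableSet
  have h1 : ∀ x, (Metric.closedBall c (L * ρ)).indicator
        (fun _ => ENNReal.ofReal (d * ρ ^ γ)) x ^ s * ENNReal.ofReal (ω x) =
      (Metric.closedBall c (L * ρ)).indicator
        (fun x => ENNReal.ofReal ((d * ρ ^ γ) ^ s) * ENNReal.ofReal (ω x)) x := by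
    intro x
    by_cases hx : x ∈ Metric.closedBall c (L * ρ)
    · rw [indicator_of_mem hx, indicator_of_mem hx, ENNReal.ofReal_rpow_of_nonneg
        (by positivity) hs.le]
    · rw [indicator_of_notMem hx, indicator_of_notMem hx, ENNReal.zero_rpow_of_pos hs, zero_mul]
  have h2 := hω.rpow_mul_setLIntegral_le hp hG hρ hL (by positivity) h
  simp_rw [h1]
  rw [lintegral_indicator hm, lintegral_const_mul' _ _ ENNReal.ofReal_ne_top, ← mul_assoc,
    ← ENNReal.ofReal_mul (by positivity)]
  have e : κ ^ p * (d * ρ ^ γ) ^ s = d ^ s * (κ * ρ ^ b) ^ p := by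
    rw [Real.mul_rpow hd (by positivity), Real.mul_rpow hκ (by positivity),
      ← Real.rpow_mul hρ.le, ← Real.rpow_mul hρ.le, hb]
    ring
  rw [e, ENNReal.ofReal_mul (by positivity), ENNReal.ofReal_mul (by positivity), mul_assoc]
  calc _ ≤ ENNReal.ofReal (d ^ s) * _ := mul_le_mul_right h2 _
    _ = _ := by ring

theorem IsMuckenhouptA1.lintegral_ballSectionBound_rpow_le {n : ℕ}
    {ω : EuclideanSpace ℝ (Fin n) → ℝ} (hω : IsMuckenhouptA1 ω) {p s b γ κ K C : ℝ} (hp : 1 ≤ p)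
    (hs : 0 < s) (hs1 : s ≤ 1) (hγ : 0 < γ) (hb : b * p = γ * s) (hκ : 0 ≤ κ) (hK : 0 ≤ K)
    (hC : 0 ≤ C)
    {G : EuclideanSpace ℝ (Fin n) → ℝ≥0∞} (hG : Measurable G) (j : ℕ)
    {c : EuclideanSpace ℝ (Fin n)} {ρ : ℝ} (hρ : 0 < ρ)
    (h : ENNReal.ofReal (κ * ρ ^ b) * volume (Metric.closedBall c ρ) ≤
      ∫⁻ x in Metric.closedBall c ρ, G x) :
    ENNReal.ofReal (κ ^ p) * ∫⁻ x, ballSectionBound K C γ j c ρ x ^ s * ENNReal.ofReal (ω x) ≤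
      muckenhouptA1Const ω * ENNReal.ofReal
        ((K ^ s * 2 ^ (γ * s) * 8 ^ n + C ^ s * 16 ^ n) / unitBallVolume n *
          ((j + 1) * 2 ^ (j * (γ * s + n * (1 - s))))) *
        ∫⁻ x in Metric.closedBall c ρ, G x ^ p * ENNReal.ofReal (ω x) := by
  have hv := unitBallVolume_pos n
  have hωm : AEMeasurable (fun x => ENNReal.ofReal (ω x)) volume :=
    hω.locallyIntegrable.aestronglyMeasurable.aemeasurable.ennreal_ofReal
  set J := ∫⁻ x in Metric.closedBall c ρ, G x ^ p * ENNReal.ofReal (ω x)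
  set β := γ * s + n * (1 - s) with hβ
  have hns : 0 ≤ (n : ℝ) * (1 - s) := mul_nonneg (Nat.cast_nonneg n) (by linarith)
  have hβ0 : 0 ≤ β := by positivity
  have hmeas : ∀ (R d : ℝ), AEMeasurable (fun x => (Metric.closedBall c R).indicator
        (fun _ => ENNReal.ofReal (d * ρ ^ γ)) x ^ s * ENNReal.ofReal (ω x)) volume := fun R d =>
    (((measurable_const.indicator Metric.isClosed_closedBall.measurableSet).pow_const
      s).aemeasurable).mul hωm
  have hpt : ∀ x, ballSectionBound K C γ j c ρ x ^ s * ENNReal.ofReal (ω x) ≤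
      (Metric.closedBall c (4 * ρ)).indicator
        (fun _ => ENNReal.ofReal (K * 2 ^ ((j + 1) * γ) * ρ ^ γ)) x ^ s * ENNReal.ofReal (ω x) +
      ∑ l ∈ Finset.range (j + 1), (Metric.closedBall c (2 ^ (l + 3) * ρ)).indicator
        (fun _ => ENNReal.ofReal (C * 2 ^ (l * (γ - n)) * ρ ^ γ)) x ^ s *
          ENNReal.ofReal (ω x) := by
    intro x
    rw [← Finset.sum_mul, ← add_mul]
    gcongr
    refine (ENNReal.rpow_add_le_add_rpow _ _ hs.le hs1).trans ?_
    gcongr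
    exact ENNReal.rpow_sum_le_sum_rpow_of_le_one _ _ hs hs1
  have hfirst := hω.lintegral_indicator_closedBall_rpow_le hp hs hb hκ hG hρ
    (show (1 : ℝ) ≤ 4 by norm_num) (show 0 ≤ K * 2 ^ (((j : ℝ) + 1) * γ) by positivity) h
  have hterm := fun l : ℕ => hω.lintegral_indicator_closedBall_rpow_le hp hs hb hκ hG hρ
    (show (1 : ℝ) ≤ 2 ^ (l + 3) from one_le_pow₀ (by norm_num))
    (show 0 ≤ C * 2 ^ ((l : ℝ) * (γ - n)) by positivity) h
  have hreal : (K * 2 ^ (((j : ℝ) + 1) * γ)) ^ s * ((2 * 4) ^ n / unitBallVolume n) +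
      ∑ l ∈ Finset.range (j + 1), (C * 2 ^ ((l : ℝ) * (γ - n))) ^ s *
        ((2 * 2 ^ (l + 3)) ^ n / unitBallVolume n) ≤
      (K ^ s * 2 ^ (γ * s) * 8 ^ n + C ^ s * 16 ^ n) / unitBallVolume n *
          ((j + 1) * 2 ^ (j * β)) := by
    have hj : (1 : ℝ) ≤ (j : ℝ) + 1 := by linarith [Nat.cast_nonneg (α := ℝ) j]
    have e1 : (K * 2 ^ (((j : ℝ) + 1) * γ)) ^ s * ((2 * 4) ^ n / unitBallVolume n) ≤
        K ^ s * 2 ^ (γ * s) * 8 ^ n / unitBallVolume n * ((j + 1) * 2 ^ (j * β)) := by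
      have e2 : (K * 2 ^ (((j : ℝ) + 1) * γ)) ^ s = K ^ s * 2 ^ (γ * s) * 2 ^ (j * (γ * s)) := by
        rw [Real.mul_rpow hK (by positivity), ← Real.rpow_mul (by norm_num),
          show ((j : ℝ) + 1) * γ * s = γ * s + j * (γ * s) by ring,
          Real.rpow_add (by norm_num)]
        ring
      have e3 : (2 : ℝ) ^ (j * (γ * s)) ≤ (j + 1) * 2 ^ (j * β) := by
        rw [← one_mul ((2 : ℝ) ^ (j * (γ * s)))]
        gcongr
        · norm_num
        · linarith
      calc _ = K ^ s * 2 ^ (γ * s) * 8 ^ n / unitBallVolume n * 2 ^ (j * (γ * s)) := by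
            rw [e2]; norm_num; ring
        _ ≤ _ := by gcongr
    -- The kernel gives `2^{l(γ-n)s}` and the dilated ball gives `2^{ln}`: together `2^{lβ}`. Since
    -- `β ≥ 0`, each term is at most the one with `l = j`, and the number of terms gives the factor
    -- `j + 1`.
    have e4 : ∀ l ∈ Finset.range (j + 1), (C * 2 ^ ((l : ℝ) * (γ - n))) ^ s *
        ((2 * 2 ^ (l + 3)) ^ n / unitBallVolume n) ≤
        C ^ s * 16 ^ n / unitBallVolume n * 2 ^ (j * β) := by
      intro l hl
      have hlj : (l : ℝ) ≤ j := by
        exact_mod_cast Nat.lt_succ_iff.1 (Finset.mem_range.1 hl)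
      have e5 : (C * 2 ^ ((l : ℝ) * (γ - n))) ^ s * (2 * 2 ^ (l + 3)) ^ n =
          C ^ s * 16 ^ n * 2 ^ (l * β) := by
        have e6 : ((2 : ℝ) * 2 ^ (l + 3)) ^ n = 16 ^ n * 2 ^ ((l : ℝ) * n) := by
          rw [show (2 : ℝ) * 2 ^ (l + 3) = 16 * 2 ^ l by ring, mul_pow, Real.rpow_mul (by norm_num),
            Real.rpow_natCast, Real.rpow_natCast]
        rw [e6, Real.mul_rpow hC (by positivity), ← Real.rpow_mul (by norm_num)]
        have e7 : (2 : ℝ) ^ (l * β) = 2 ^ (l * (γ - n) * s) * 2 ^ ((l : ℝ) * n) := by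
          rw [← Real.rpow_add (by norm_num)]
          congr 1; rw [hβ]; ring
        rw [e7]; ring
      calc _ = C ^ s * 16 ^ n / unitBallVolume n * 2 ^ (l * β) := by
            rw [← mul_div_assoc, e5]; ring
        _ ≤ _ := by gcongr; norm_num
    refine (add_le_add e1 (Finset.sum_le_sum e4)).trans_eq ?_
    rw [Finset.sum_const, Finset.card_range, nsmul_eq_mul]
    push_cast; ring
  calc _ ≤ ENNReal.ofReal (κ ^ p) * ∫⁻ x, ((Metric.closedBall c (4 * ρ)).indicator
          (fun _ => ENNReal.ofReal (K * 2 ^ ((j + 1) * γ) * ρ ^ γ)) x ^ s * ENNReal.ofReal (ω x) +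
        ∑ l ∈ Finset.range (j + 1), (Metric.closedBall c (2 ^ (l + 3) * ρ)).indicator
          (fun _ => ENNReal.ofReal (C * 2 ^ (l * (γ - n)) * ρ ^ γ)) x ^ s *
            ENNReal.ofReal (ω x)) := by
        exact mul_le_mul_right (lintegral_mono hpt) _
    _ ≤ muckenhouptA1Const ω * ENNReal.ofReal
          ((K * 2 ^ (((j : ℝ) + 1) * γ)) ^ s * ((2 * 4) ^ n / unitBallVolume n)) * J +
        ∑ l ∈ Finset.range (j + 1), muckenhouptA1Const ω * ENNReal.ofReal
          ((C * 2 ^ ((l : ℝ) * (γ - n))) ^ s * ((2 * 2 ^ (l + 3)) ^ n / unitBallVolume n)) *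
            J := by
        rw [lintegral_add_left' (hmeas _ _), lintegral_finsetSum' _ fun l _ => hmeas _ _, mul_add,
          Finset.mul_sum]
        exact add_le_add hfirst (Finset.sum_le_sum fun l _ => hterm l)
    _ ≤ _ := by
        rw [← Finset.sum_mul, ← Finset.mul_sum, ← add_mul, ← mul_add,
          ← ENNReal.ofReal_sum_of_nonneg (fun l _ => by positivity),
          ← ENNReal.ofReal_add (by positivity) (Finset.sum_nonneg fun l _ => by positivity)]
        gcongr

/-! ### Covering the level set by the selected balls. -/

theorem measurableSet_prodMk_preimage_diffQuotSet {n : ℕ} {𝕜 : Type*} [RCLike 𝕜]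
    {f : EuclideanSpace ℝ (Fin n) → 𝕜} (hf : Continuous f) (lam b : ℝ)
    (x : EuclideanSpace ℝ (Fin n)) : MeasurableSet (Prod.mk x ⁻¹' diffQuotSet lam b f) := by
  have h1 : MeasurableSet {y | x ≠ y} := by
    have : {y | x ≠ y} = {x}ᶜ := by ext y; simp [eq_comm]
    rw [this]; exact (measurableSet_singleton x).compl
  have hm : Measurable fun y => ‖f x - f y‖ / ‖x - y‖ ^ (1 + b) := by
    have : Measurable f := hf.measurable
    fun_prop
  exact h1.inter (measurableSet_lt measurable_const hm)

theorem lintegral_indicator_diffQuotSet {n : ℕ} {𝕜 : Type*} [RCLike 𝕜]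
    {f : EuclideanSpace ℝ (Fin n) → 𝕜} (hf : Continuous f) (lam b α : ℝ)
    (x : EuclideanSpace ℝ (Fin n)) :
    ∫⁻ y, (diffQuotSet lam b f).indicator
        (fun z => ENNReal.ofReal (‖z.1 - z.2‖ ^ α)) (x, y) =
      ∫⁻ y in Prod.mk x ⁻¹' diffQuotSet lam b f, ENNReal.ofReal (‖x - y‖ ^ α) := by
  rw [← lintegral_indicator (measurableSet_prodMk_preimage_diffQuotSet hf lam b x)]
  rfl

/-- The centres and radii of the balls over which `G` has average larger than `κ * ρ ^ b`, where
`ρ` is the radius. -/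
def largeAverageBalls {n : ℕ} (G : EuclideanSpace ℝ (Fin n) → ℝ≥0∞) (κ b : ℝ) :
    Set (EuclideanSpace ℝ (Fin n) × ℝ) :=
  {z | 0 < z.2 ∧ ENNReal.ofReal (κ * z.2 ^ b) * volume (Metric.closedBall z.1 z.2) <
    ∫⁻ x in Metric.closedBall z.1 z.2, G x}

/-- Vitali's lemma needs bounded radii. An average never exceeds `M`, while the threshold `κ * ρ ^
b` grows with `ρ` because `b > 0`. -/
theorem radius_le_of_mem_largeAverageBalls {n : ℕ} {G : EuclideanSpace ℝ (Fin n) → ℝ≥0∞}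
    {κ b M : ℝ} (hκ : 0 < κ) (hb : 0 < b) (hG : ∀ x, G x ≤ ENNReal.ofReal M) :
    ∀ z ∈ largeAverageBalls G κ b, z.2 ≤ (M / κ) ^ (1 / b) := by
  rintro ⟨c, ρ⟩ ⟨hρ, h⟩
  simp only at hρ h ⊢
  have h1 : ∫⁻ x in Metric.closedBall c ρ, G x ≤
      ENNReal.ofReal M * volume (Metric.closedBall c ρ) := by
    rw [← setLIntegral_const]
    exact lintegral_mono fun x => hG x
  have h2 := lt_of_mul_lt_mul_left' (lt_of_lt_of_eq (lt_of_eq_of_lt (mul_comm _ _)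
    (h.trans_le h1)) (mul_comm _ _))
  have h3 := (ENNReal.ofReal_lt_ofReal_iff_of_nonneg (by positivity)).1 h2
  have h4 : ρ ^ b ≤ M / κ := by rw [le_div_iff₀ hκ]; linarith
  calc ρ = (ρ ^ b) ^ (1 / b) := by
        rw [← Real.rpow_mul hρ.le, mul_one_div_cancel hb.ne', Real.rpow_one]
    _ ≤ _ := by gcongr

theorem exists_bound_ofReal_gradNorm {n : ℕ} {𝕜 : Type*} [RCLike 𝕜]
    {f : EuclideanSpace ℝ (Fin n) → 𝕜} (hf : ContDiff ℝ 1 f)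
    (hc : HasCompactSupport (gradNorm f)) :
    ∃ M : ℝ, ∀ x, ENNReal.ofReal (gradNorm f x) ≤ ENNReal.ofReal M := by
  obtain ⟨M, hM⟩ := hc.exists_bound_of_continuous (continuous_gradNorm hf)
  exact ⟨M, fun x =>
    ENNReal.ofReal_le_ofReal ((le_abs_self _).trans (hM x))⟩

theorem diffQuotSet_section_subset_iUnion_ballSection {n : ℕ} {𝕜 : Type*} [RCLike 𝕜]
    {f : EuclideanSpace ℝ (Fin n) → 𝕜} (hf : ContDiff ℝ 1 f) {a b lam : ℝ} (ha0 : 0 ≤ a)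
    (ha : a < 1) (hlam : 0 < lam)
    (u : ℕ → Set (EuclideanSpace ℝ (Fin n) × ℝ))
    (hu : ∀ j : ℕ, ∀ z ∈ largeAverageBalls (fun x => ENNReal.ofReal (gradNorm f x))
        ((1 - a) / 2 ^ (2 * n + 1) * lam * 2 ^ (j * (a + b))) b,
      ∃ w ∈ u j, z.1 ∈ Metric.closedBall w.1 (3 * w.2) ∧ z.2 ≤ 2 * w.2)
    (x : EuclideanSpace ℝ (Fin n)) :
    Prod.mk x ⁻¹' diffQuotSet lam b f ⊆ ⋃ j, ⋃ w : u j, ballSection j w.1.1 w.1.2 x := by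
  rintro y ⟨hxy, hlt⟩
  simp only at hxy hlt
  have h1a : 0 < 1 - a := by linarith
  set r := ‖x - y‖ with hr
  have hr0 : 0 < r := norm_pos_iff.2 (sub_ne_zero.2 hxy)
  set c := (1 - a) / 2 ^ (2 * n + 1) with hc
  have hc0 : 0 < c := by positivity
  rw [lt_div_iff₀ (by positivity), Real.rpow_add hr0, Real.rpow_one] at hlt
  have hlt' : r * (2 ^ (2 * n + 1) * (c * lam * r ^ b) / (1 - a)) < ‖f x - f y‖ := by
    refine lt_of_eq_of_lt ?_ hlt
    rw [hc]; field_simp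
  obtain ⟨j, w, hw, hbad⟩ := exists_lt_setLIntegral_gradNorm hf ha0 ha
    (show 0 ≤ c * lam * r ^ b by positivity) hxy hr hlt'
  -- The threshold is re-expressed in the ball's own radius `ρ = 2^{-j} r`: the factor `r^b = 2^{jb}
  -- ρ^b` turns `2^{ja}` into `2^{j(a+b)}`.
  have hmem : (w, (1 / 2) ^ j * r) ∈ largeAverageBalls (fun x => ENNReal.ofReal (gradNorm f x))
      (c * lam * 2 ^ (j * (a + b))) b := by
    refine ⟨by positivity, lt_of_eq_of_lt ?_ hbad⟩
    congr 2
    have e : (2 : ℝ) ^ ((j : ℝ) * (a + b)) * ((1 / 2 : ℝ) ^ j) ^ b = 2 ^ ((j : ℝ) * a) := by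
      rw [one_div, ← Real.rpow_natCast, ← Real.rpow_mul (by norm_num),
        Real.inv_rpow (by norm_num), ← Real.rpow_neg (by norm_num), ← Real.rpow_add (by norm_num)]
      congr 1; ring
    simp only
    rw [Real.mul_rpow (by positivity) hr0.le, ← e]
    ring
  obtain ⟨v, hv, hwv, hle⟩ := hu j _ hmem
  simp only at hwv hle
  refine mem_iUnion₂.2 ⟨j, ⟨v, hv⟩, ?_, ?_⟩
  · rcases hw with rfl | rfl
    · exact Or.inl hwv
    · exact Or.inr hwv
  · have e : r = 2 ^ j * ((1 / 2) ^ j * r) := by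
      rw [← mul_assoc, ← mul_pow]; norm_num
    calc ‖x - y‖ = 2 ^ j * ((1 / 2) ^ j * r) := e
      _ ≤ 2 ^ j * (2 * v.2) := by gcongr
      _ = _ := by ring

/-! ### Summation over scales, and reduction of the full range. -/

/-- The weak-type estimate in the range `p ≤ q`. -/
theorem exists_lintegral_diffQuotSet_le_of_le {n : ℕ} (hn : 1 ≤ n) {γ p q : ℝ} (hγ : 0 < γ)
    (hp : 1 ≤ p) (hq : p ≤ q) (hpq : (n : ℝ) * (1 / p - 1 / q) < 1) :
    ∃ C₀ : ℝ, 0 ≤ C₀ ∧ ∀ ω : EuclideanSpace ℝ (Fin n) → ℝ, IsMuckenhouptA1 ω →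
      ∀ {𝕜 : Type*} [RCLike 𝕜] (f : EuclideanSpace ℝ (Fin n) → 𝕜), ContDiff ℝ 1 f →
        HasCompactSupport (gradNorm f) → ∀ lam : ℝ, 0 < lam →
          ENNReal.ofReal (lam ^ p) * ∫⁻ x, (∫⁻ y in Prod.mk x ⁻¹' diffQuotSet lam (γ / q) f,
            ENNReal.ofReal (‖x - y‖ ^ (γ - n))) ^ (p / q) * ENNReal.ofReal (ω x) ≤
          muckenhouptA1Const ω * ENNReal.ofReal C₀ *
            ∫⁻ x, ENNReal.ofReal (gradNorm f x ^ p * ω x) := by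
  obtain ⟨K, hK0, hK⟩ := exists_setLIntegral_rieszKernel_le hn hγ
  have hv := unitBallVolume_pos n
  have hp0 : 0 < p := by linarith
  have hq0 : 0 < q := by linarith
  set b := γ / q with hb
  set s := p / q with hs
  have hb0 : 0 < b := by positivity
  have hs0 : 0 < s := by positivity
  have hs1 : s ≤ 1 := by rw [hs, div_le_one hq0]; exact hq
  have hbp : b * p = γ * s := by rw [hb, hs]; field_simp
  have hδ : 0 ≤ (n : ℝ) * (1 / p - 1 / q) :=
    mul_nonneg (Nat.cast_nonneg n) (sub_nonneg.2 (one_div_le_one_div_of_le hp0 hq))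
  -- The upper bound `a < 1` serves the oscillation estimate; the strict lower bound gives `θ < 1`.
  obtain ⟨a, ha1, ha⟩ := exists_between hpq
  have ha0 : 0 ≤ a := hδ.trans ha1.le
  have h1a : 0 < 1 - a := by linarith
  set c := (1 - a) / 2 ^ (2 * n + 1) with hc
  have hc0 : 0 < c := by positivity
  set C := (2 : ℝ) ^ |γ - n| * (3 ^ n * unitBallVolume n) with hC
  have hC0 : 0 ≤ C := by positivity
  set D := (K ^ s * 2 ^ (γ * s) * 8 ^ n + C ^ s * 16 ^ n) / unitBallVolume n with hD
  have hD0 : 0 ≤ D := by positivity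
  set θ := (2 : ℝ) ^ (n * (1 - s) - p * a) with hθ
  have hθ0 : 0 < θ := by positivity
  have hθ1 : θ < 1 := by
    apply Real.rpow_lt_one_of_one_lt_of_neg (by norm_num)
    have : (n : ℝ) * (1 - s) = p * (n * (1 / p - 1 / q)) := by rw [hs]; field_simp
    rw [this, ← mul_sub]
    exact mul_neg_of_pos_of_neg hp0 (by linarith)
  set e : ℕ → ℝ := fun j => c⁻¹ ^ p * D * ((j + 1) * θ ^ j) with he
  have he0 : ∀ j, 0 ≤ e j := fun j => by positivity
  have hsum : Summable e := by
    have h1 := summable_pow_mul_geometric_of_norm_lt_one (R := ℝ) 1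
      (by rwa [Real.norm_eq_abs, abs_of_pos hθ0] : ‖θ‖ < 1)
    have h2 := summable_geometric_of_lt_one hθ0.le hθ1
    refine Summable.mul_left _ ((h1.add h2).congr fun j => ?_)
    rw [pow_one]; ring
  refine ⟨∑' j, e j, tsum_nonneg he0, fun ω hω 𝕜 _ f hf hfc lam hlam => ?_⟩
  set G : EuclideanSpace ℝ (Fin n) → ℝ≥0∞ := fun x => ENNReal.ofReal (gradNorm f x) with hG
  have hGm : Measurable G := (continuous_gradNorm hf).measurable.ennreal_ofReal
  have hωm : AEMeasurable (fun x => ENNReal.ofReal (ω x)) volume :=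
    hω.locallyIntegrable.aestronglyMeasurable.aemeasurable.ennreal_ofReal
  obtain ⟨M, hM⟩ := exists_bound_ofReal_gradNorm hf hfc
  set κ : ℕ → ℝ := fun j => c * lam * 2 ^ (j * (a + b)) with hκ
  have hκ0 : ∀ j, 0 < κ j := fun j => by positivity
  choose u hut hucount hudisj hucov using fun j => exists_countable_disjoint_closedBall_cover
    (largeAverageBalls G (κ j) b) (fun z hz => hz.1)
    (radius_le_of_mem_largeAverageBalls (hκ0 j) hb0 hM)
  have hcount : ∀ j, Countable (u j) := fun j => (hucount j).to_subtype
  set Ψ : (j : ℕ) → u j → EuclideanSpace ℝ (Fin n) → ℝ≥0∞ := fun j w x =>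
    ballSectionBound K C γ j w.1.1 w.1.2 x ^ s * ENNReal.ofReal (ω x) with hΨ
  have hΨm : ∀ j w, AEMeasurable (Ψ j w) volume := fun j w =>
    ((measurable_ballSectionBound _ _ _ _ _ _).pow_const s).aemeasurable.mul hωm
  have hpt : ∀ x, (∫⁻ y in Prod.mk x ⁻¹' diffQuotSet lam b f,
      ENNReal.ofReal (‖x - y‖ ^ (γ - n))) ^ s * ENNReal.ofReal (ω x) ≤
      ∑' j, ∑' w, Ψ j w x := by
    intro x
    simp only [hΨ, ENNReal.tsum_mul_right]
    gcongr
    calc _ ≤ (∑' j, ∑' w : u j, ballSectionBound K C γ j w.1.1 w.1.2 x) ^ s := by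
          gcongr
          refine (lintegral_mono_set (diffQuotSet_section_subset_iUnion_ballSection hf ha0 ha hlam
            u hucov x)).trans ((lintegral_iUnion_le _ _).trans (ENNReal.tsum_le_tsum fun j => ?_))
          refine (lintegral_iUnion_le _ _).trans (ENNReal.tsum_le_tsum fun w => ?_)
          exact setLIntegral_ballSection_le hK j _ (hut j w.2).1 x
      _ ≤ ∑' j, (∑' w : u j, ballSectionBound K C γ j w.1.1 w.1.2 x) ^ s :=
          ENNReal.rpow_tsum_le_tsum_rpow_of_le_one _ hs0 hs1
      _ ≤ _ := ENNReal.tsum_le_tsum fun j => ENNReal.rpow_tsum_le_tsum_rpow_of_le_one _ hs0 hs1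
  set H : EuclideanSpace ℝ (Fin n) → ℝ≥0∞ := fun x => G x ^ p * ENNReal.ofReal (ω x) with hH
  have hball : ∀ j (w : u j), ENNReal.ofReal (lam ^ p) * ∫⁻ x, Ψ j w x ≤
      muckenhouptA1Const ω * ENNReal.ofReal (e j) *
        ∫⁻ x in Metric.closedBall w.1.1 w.1.2, H x := by
    intro j w
    have h1 := hω.lintegral_ballSectionBound_rpow_le hp hs0 hs1 hγ hbp (hκ0 j).le hK0.le hC0 hGm j
      (hut j w.2).1 (hut j w.2).2.le
    have e1 : lam ^ p = (lam / κ j) ^ p * κ j ^ p := by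
      rw [← Real.mul_rpow (by have := hκ0 j; positivity) (hκ0 j).le,
        div_mul_cancel₀ _ (hκ0 j).ne']
    -- Because `b * p = γ * s`, the loss `2^{jγs}` cancels against `2^{-jbp}`, leaving `2^{j(n(1-s)
    -- - pa)} = θ^j`.
    have e2 : (lam / κ j) ^ p * (D * ((j + 1) * 2 ^ (j * (γ * s + n * (1 - s))))) = e j := by
      have e3 : lam / κ j = c⁻¹ * 2 ^ (-(j * (a + b))) := by
        rw [hκ, Real.rpow_neg (by norm_num)]; field_simp
      have e4 : θ ^ j = 2 ^ (-(j * (a + b)) * p) * 2 ^ (j * (γ * s + n * (1 - s))) := by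
        rw [hθ, ← Real.rpow_natCast, ← Real.rpow_mul (by norm_num),
          ← Real.rpow_add (by norm_num), ← hbp]
        congr 1; ring
      simp only [he]
      rw [e3, Real.mul_rpow (by positivity) (by positivity), ← Real.rpow_mul (by norm_num), e4]
      ring
    have hnn : 0 ≤ (lam / κ j) ^ p := by have := hκ0 j; positivity
    rw [e1, ← e2, ENNReal.ofReal_mul hnn, ENNReal.ofReal_mul hnn, mul_assoc]
    refine (mul_le_mul_right h1 _).trans_eq ?_
    ring
  have hdisj : ∀ j, ∑' w : u j, ∫⁻ x in Metric.closedBall w.1.1 w.1.2, H x ≤ ∫⁻ x, H x := by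
    intro j
    have h1 := lintegral_iUnion (μ := volume)
      (s := fun w : u j => Metric.closedBall w.1.1 w.1.2)
      (fun w => Metric.isClosed_closedBall.measurableSet)
      ((pairwise_subtype_iff_pairwise_set _ _).2 (hudisj j)) H
    rw [← h1]
    exact setLIntegral_le_lintegral _ _
  have hHeq : ∫⁻ x, ENNReal.ofReal (gradNorm f x ^ p * ω x) = ∫⁻ x, H x := by
    refine lintegral_congr fun x => ?_
    have hg : 0 ≤ gradNorm f x := Real.sqrt_nonneg _
    simp only [hH, hG]
    rw [ENNReal.ofReal_mul (by positivity), ENNReal.ofReal_rpow_of_nonneg hg hp0.le]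
  rw [hHeq]
  calc _ ≤ ENNReal.ofReal (lam ^ p) * ∫⁻ x, ∑' j, ∑' w, Ψ j w x :=
        mul_le_mul_right (lintegral_mono hpt) _
    _ = ∑' j, ∑' w, ENNReal.ofReal (lam ^ p) * ∫⁻ x, Ψ j w x := by
        rw [lintegral_tsum fun j => AEMeasurable.tsum fun w => hΨm j w]
        simp_rw [lintegral_tsum (hΨm _), ENNReal.tsum_mul_left]
    _ ≤ ∑' j, ∑' w : u j, muckenhouptA1Const ω * ENNReal.ofReal (e j) *
          ∫⁻ x in Metric.closedBall w.1.1 w.1.2, H x :=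
        ENNReal.tsum_le_tsum fun j => ENNReal.tsum_le_tsum fun w => hball j w
    _ ≤ ∑' j, muckenhouptA1Const ω * ENNReal.ofReal (e j) * ∫⁻ x, H x := by
        refine ENNReal.tsum_le_tsum fun j => ?_
        rw [ENNReal.tsum_mul_left]
        exact mul_le_mul_right (hdisj j) _
    _ = _ := by
        rw [ENNReal.tsum_mul_right, ENNReal.tsum_mul_left,
          ← ENNReal.ofReal_tsum_of_nonneg he0 hsum]

/-- The weak-type estimate in the full range. -/
theorem exists_lintegral_diffQuotSet_le {n : ℕ} (hn : 1 ≤ n) {γ p q : ℝ} (hγ : 0 < γ)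
    (hp : 1 ≤ p) (hq : 0 < q) (hpq : (n : ℝ) * (1 / p - 1 / q) < 1) :
    ∃ C₀ : ℝ, 0 ≤ C₀ ∧ ∀ ω : EuclideanSpace ℝ (Fin n) → ℝ, IsMuckenhouptA1 ω →
      ∀ {𝕜 : Type*} [RCLike 𝕜] (f : EuclideanSpace ℝ (Fin n) → 𝕜), ContDiff ℝ 1 f →
        HasCompactSupport (gradNorm f) → ∀ lam : ℝ, 0 < lam →
          ENNReal.ofReal (lam ^ p) * ∫⁻ x, (∫⁻ y in Prod.mk x ⁻¹' diffQuotSet lam (γ / q) f,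
            ENNReal.ofReal (‖x - y‖ ^ (γ - n))) ^ (p / q) * ENNReal.ofReal (ω x) ≤
          muckenhouptA1Const ω * ENNReal.ofReal C₀ *
            ∫⁻ x, ENNReal.ofReal (gradNorm f x ^ p * ω x) := by
  rcases le_or_gt p q with h | h
  · exact exists_lintegral_diffQuotSet_le_of_le hn hγ hp h hpq
  have hp0 : 0 < p := by linarith
  -- Applied with `γ * (p / q)` and both exponents equal to `p`: the quotient `γ * (p / q) / p` is
  -- again `γ / q`, so the level set is unchanged and the outer power becomes one.
  obtain ⟨C₁, hC₁, hmain⟩ := exists_lintegral_diffQuotSet_le_of_le hn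
    (show 0 < γ * (p / q) by positivity) hp le_rfl (by simp)
  obtain ⟨K, hK0, hK⟩ := rpow_setLIntegral_rieszKernel_le hn hγ
    (show 1 ≤ p / q by rw [one_le_div hq]; exact h.le)
  refine ⟨K * C₁, by positivity, fun ω hω 𝕜 _ f hf hfc lam hlam => ?_⟩
  have h1 := hmain ω hω f hf hfc lam hlam
  have e1 : γ * (p / q) / p = γ / q := by field_simp
  rw [e1, div_self hp0.ne'] at h1
  simp_rw [ENNReal.rpow_one] at h1
  calc _ ≤ ENNReal.ofReal (lam ^ p) * ∫⁻ x, ENNReal.ofReal K *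
        ((∫⁻ y in Prod.mk x ⁻¹' diffQuotSet lam (γ / q) f,
          ENNReal.ofReal (‖x - y‖ ^ (γ * (p / q) - n))) * ENNReal.ofReal (ω x)) := by
        refine mul_le_mul_right (lintegral_mono fun x => ?_) _
        rw [← mul_assoc]
        gcongr
        exact hK x _ (measurableSet_prodMk_preimage_diffQuotSet hf.continuous _ _ x)
    _ = ENNReal.ofReal K * (ENNReal.ofReal (lam ^ p) * ∫⁻ x,
        ((∫⁻ y in Prod.mk x ⁻¹' diffQuotSet lam (γ / q) f,
          ENNReal.ofReal (‖x - y‖ ^ (γ * (p / q) - n))) * ENNReal.ofReal (ω x))) := by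
        rw [lintegral_const_mul' _ _ ENNReal.ofReal_ne_top]
        ring
    _ ≤ ENNReal.ofReal K * _ := mul_le_mul_right h1 _
    _ = _ := by
        rw [ENNReal.ofReal_mul hK0.le]
        ring

theorem proposition2010 {𝕜 : Type*} [RCLike 𝕜] (n : ℕ) (hn : 1 ≤ n) (γ p q : ℝ) (hγ : 0 < γ)
    (hp : 1 ≤ p) (hq : 0 < q) (hpq : (n : ℝ) * (1 / p - 1 / q) < 1) :
    ∃ C : ℝ → ℝ, ContinuousOn C (Set.Ici 1) ∧ StrictMonoOn C (Set.Ici 1) ∧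
      (∀ t ∈ Set.Ici (1 : ℝ), 0 < C t) ∧
      ∀ ω : EuclideanSpace ℝ (Fin n) → ℝ, IsMuckenhouptA1 ω →
        ∀ f : EuclideanSpace ℝ (Fin n) → 𝕜, ContDiff ℝ 1 f → HasCompactSupport (gradNorm f) →
          (⨆ lam ∈ Set.Ioi (0 : ℝ), ENNReal.ofReal (lam ^ p) *
            ∫⁻ x, (∫⁻ y, (diffQuotSet lam (γ / q) f).indicator
                (fun z => ENNReal.ofReal (‖z.1 - z.2‖ ^ (γ - (n : ℝ)))) (x, y)) ^ (p / q) *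
              ENNReal.ofReal (ω x)) ≤
          ENNReal.ofReal (C (muckenhouptA1Const ω).toReal) *
            ∫⁻ x, ENNReal.ofReal (gradNorm f x ^ p * ω x) := by
  obtain ⟨C₀, hC₀, hmain⟩ := exists_lintegral_diffQuotSet_le hn hγ hp hq hpq
  have hpos : 0 < C₀ + 1 := by linarith
  -- The added `1` keeps the slope positive even if `C₀ = 0`, as strict monotonicity and positivity
  -- require.
  refine ⟨fun t => t * (C₀ + 1), by fun_prop, ?_, ?_, ?_⟩
  · exact fun t _ t' _ htt => mul_lt_mul_of_pos_right htt hpos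
  · exact fun t ht => mul_pos (one_pos.trans_le ht) hpos
  intro ω hω f hf hfc
  refine iSup₂_le fun lam hlam => ?_
  simp_rw [lintegral_indicator_diffQuotSet hf.continuous]
  refine (hmain ω hω f hf hfc lam hlam).trans ?_
  rw [ENNReal.ofReal_mul ENNReal.toReal_nonneg, ENNReal.ofReal_toReal hω.const_lt_top.ne]
  gcongr
  linarith
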